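/- For a polynomial $F\in\mathbb R[x]$ let $L(F)$ denote the sum of the absolute values of its coefficients. For an algebraic number $b$ let $P\in\mathbb Z[x]$ be its minimal polynomial over $\mathbb Z$ (irreducible in $\mathbb Z[x]$, with positive leading coefficient and $P(b)=0$), and let the reduced length of $b$ be $$\ell(b)=\inf_{G\in\Gamma}L(PG),$$ where $\Gamma$ is the set of all $G\in\mathbb R[x]$ whose constant coefficient or leading coefficient equals $1$. A set $S\subseteq\mathbb R$ is called $(1-\epsilon)$-large if it is Lebesgue measurable and $|S\cap I|\ge 1-\epsilon$ for every interval $I\subset\mathbb R$ of length $1$, where $|\cdot|$ is Lebesgue measure. **Theorem.** Let $b>1$ be a real algebraic number. For every $\epsilon\in(1-1/\ell(b),1]$ there exists a $(1-\epsilon)$-large set $S\subset\mathbb R$ that contains no affine copy of $\{b^n\}$; that is, there are no $x\in\mathbb R\setminus\{0\}$ and $t\in\mathbb R$ such that $xb^n+t\in S$ for all integers $n\ge 0$. -/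

import Mathlib

open Polynomial

noncomputable section

/-- `S` is `c`-large: Lebesgue measurable, and `|S ∩ I| ≥ c` for every interval `I` of unit
length. (Taking `I` closed loses nothing, as end points are null.) -/
def IsLargeSet (c : ℝ) (S : Set ℝ) : Prop :=
  MeasureTheory.NullMeasurableSet S MeasureTheory.volume ∧
    ∀ a : ℝ, ENNReal.ofReal c ≤ MeasureTheory.volume (S ∩ Set.Icc a (a + 1))

/-- `S` contains a nontrivial affine copy `x A + t`, `x ≠ 0`, of `A`. -/
def ContainsAffineCopy (S A : Set ℝ) : Prop :=
  ∃ x t : ℝ, x ≠ 0 ∧ (fun a : ℝ => x * a + t) '' A ⊆ S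

/-- The length of a real polynomial: the sum of the absolute values of its coefficients. -/
def polyLength (F : ℝ[X]) : ℝ := ∑ i ∈ F.support, |F.coeff i|

/-- Real polynomials whose constant coefficient or leading coefficient is `1`. -/
def GammaSet : Set ℝ[X] := {G | G.coeff 0 = 1 ∨ G.leadingCoeff = 1}

/-- The minimal polynomial over `ℤ` of an algebraic number `b`: the primitive integer multiple of
`minpoly ℚ b` with positive leading coefficient. -/
def intMinpoly (b : ℝ) : ℤ[X] :=
  normalize (IsLocalization.integerNormalization (nonZeroDivisors ℤ) (minpoly ℚ b)).primPart

/-- For algebraic `b`, `intMinpoly b` has the defining properties of the minimal polynomial of `b`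
in `ℤ[X]`: it is irreducible in `ℤ[X]` (in particular primitive), has positive leading coefficient,
and vanishes at `b`. -/
theorem intMinpoly_spec {b : ℝ} (hb : IsAlgebraic ℚ b) :
    Irreducible (intMinpoly b) ∧ 0 < (intMinpoly b).leadingCoeff ∧ aeval b (intMinpoly b) = 0 := by
  set m := minpoly ℚ b with hm
  set q := IsLocalization.integerNormalization (nonZeroDivisors ℤ) m with hq
  have hint : IsIntegral ℚ b := hb.isIntegral
  have hm0 : m ≠ 0 := minpoly.ne_zero hint
  have hq0 : q ≠ 0 := fun h =>
    hm0 ((IsLocalization.integerNormalization_eq_zero_iff le_rfl m).1 h)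
  have hroot : aeval b q.primPart = 0 :=
    aeval_primPart_eq_zero hq0
      (IsLocalization.integerNormalization_aeval_eq_zero _ m (minpoly.aeval ℚ b))
  have hirr : Irreducible q.primPart := by
    rw [q.isPrimitive_primPart.irreducible_iff_irreducible_map_fraction_map (K := ℚ)]
    obtain ⟨c, hc, hcq⟩ := IsLocalization.integerNormalization_spec (nonZeroDivisors ℤ) m
    have hc0 : (c : ℚ) ≠ 0 := by exact_mod_cast nonZeroDivisors.ne_zero hc
    have hk0 : (q.content : ℚ) ≠ 0 := by
      exact_mod_cast fun h => hq0 (content_eq_zero_iff.1 h)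
    have h1 : C (q.content : ℚ) * q.primPart.map (algebraMap ℤ ℚ) = C (c : ℚ) * m := by
      have h2 : (C q.content * q.primPart).map (algebraMap ℤ ℚ) = c • m := by
        rw [← q.eq_C_content_mul_primPart]; exact hcq
      rw [Polynomial.map_mul, map_C] at h2
      rw [← smul_eq_C_mul (c : ℚ), Int.cast_smul_eq_zsmul]
      exact h2
    have h3 : Irreducible (C (c : ℚ) * m) :=
      (irreducible_isUnit_mul (isUnit_C.2 hc0.isUnit)).2 (minpoly.irreducible hint)
    rw [← h1] at h3
    exact (irreducible_isUnit_mul (isUnit_C.2 hk0.isUnit)).1 h3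
  have hass : Associated q.primPart (intMinpoly b) := (normalize_associated q.primPart).symm
  refine ⟨hass.irreducible hirr, ?_, ?_⟩
  · have h : (intMinpoly b).leadingCoeff = normalize q.primPart.leadingCoeff :=
      leadingCoeff_normalize _
    rw [h, ← Int.abs_eq_normalize]
    exact abs_pos.2 (leadingCoeff_ne_zero.2 hirr.ne_zero)
  · obtain ⟨u, hu⟩ := hass
    rw [← hu, map_mul, hroot, zero_mul]

/-- The reduced length `ℓ(b) = inf_{G ∈ Γ} L(P G)`, `P` the minimal polynomial of `b` in `ℤ[X]`. -/
def reducedLength (b : ℝ) : ℝ :=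
  sInf ((fun G : ℝ[X] => polyLength ((intMinpoly b).map (Int.castRingHom ℝ) * G)) '' GammaSet)

end

/-!
Fix `δ` slightly above `1 - ε` and `G ∈ Γ` with `δ L(PG) < 1`, and start from the set of reals with
fractional part below `δ`. If it contains all `x bⁿ + t`, put `mₙ = ⌊x bⁿ + t⌋`. Since `P(shift)`
kills `x bⁿ`, the integer sequence `u = P(shift) m` is bounded, and `G(shift) u = (PG)(shift) m`
oscillates by at most `δ L(PG) < 1`. As `G` has an end coefficient `1`, each term of `u` is
determined by a window of its neighbours on one side, so there are only countably many such `u`,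
hence countably many `m`, hence countably many `x`. The translates of these countably many dilates
are destroyed by removing a union of intervals of length `δ - (1 - ε)`, far apart from
each other: one for each dilate `x` and each of countably many ranges for `t`.
-/

open Set Bornology MeasureTheory

/-! ### Deterministic sequences with finite range -/

section Deterministic

variable {α : Type*}

theorem countable_setOf_finite_range_deterministic [Countable α] :
    {w : ℕ → α | (range w).Finite ∧ ∀ m n, w m = w n → w (m + 1) = w (n + 1)}.Countable := by
  refine (countable_range fun p : Σ T : Finset α, (T → T) × T =>
    fun n => (p.2.1^[n] p.2.2 : α)).mono ?_
  rintro w ⟨hfin, hw⟩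
  let v : ℕ → hfin.toFinset := fun n => ⟨w n, hfin.mem_toFinset.2 (mem_range_self n)⟩
  have hv : (fun n => v (n + 1)).FactorsThrough v := fun m n h =>
    Subtype.ext (hw m n (congrArg Subtype.val h))
  let next := Function.extend v (fun n => v (n + 1)) fun _ => v 0
  have hnext : ∀ n, next^[n] (v 0) = v n := by
    intro n
    induction n with
    | zero => rfl
    | succ n ih =>
      rw [Function.iterate_succ_apply', ih]
      exact hv.extend_apply _ n
  exact ⟨⟨hfin.toFinset, next, v 0⟩, funext fun n => congrArg Subtype.val (hnext n)⟩

-- The map `w (n + 1) ↦ w n` is onto the finite set `range w`, hence injective on it.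
theorem succ_eq_succ_of_finite_range {w : ℕ → α} (hfin : (range w).Finite)
    (hw : ∀ m n, w (m + 1) = w (n + 1) → w m = w n) {m n : ℕ} (h : w m = w n) :
    w (m + 1) = w (n + 1) := by
  let prev := Function.extend (fun n => w (n + 1)) w fun _ => w 0
  have hprev : ∀ n, prev (w (n + 1)) = w n := fun n =>
    Function.FactorsThrough.extend_apply (f := fun n => w (n + 1)) (fun m n => hw m n) _ n
  have hmaps : MapsTo prev (range w) (range w) := by
    rintro x -
    by_cases hx : ∃ n, w (n + 1) = x
    · obtain ⟨n, rfl⟩ := hx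
      exact ⟨n, (hprev n).symm⟩
    · exact ⟨0, (Function.extend_apply' w (fun _ => w 0) x hx).symm⟩
  have hsurj : SurjOn prev (range w) (range w) := by
    rintro _ ⟨n, rfl⟩
    exact ⟨w (n + 1), mem_range_self _, hprev n⟩
  refine ((hfin.surjOn_iff_bijOn_of_mapsTo hmaps).1 hsurj).injOn (mem_range_self _)
    (mem_range_self _) ?_
  rw [hprev, hprev, h]

/-- The block of `d + 1` consecutive terms of the sequence `u` that starts at index `n`. -/
def window (d : ℕ) (u : ℕ → α) (n : ℕ) : Fin (d + 1) → α := fun i => u (n + i)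

theorem window_eq_window_iff {d : ℕ} {u : ℕ → α} {m n : ℕ} :
    window d u m = window d u n ↔ ∀ i ≤ d, u (m + i) = u (n + i) :=
  ⟨fun h i hi => congrFun h ⟨i, Nat.lt_succ_of_le hi⟩,
    fun h => funext fun i => h i (Nat.le_of_lt_succ i.2)⟩

theorem window_injective (d : ℕ) : Function.Injective (window d : (ℕ → α) → _) :=
  fun _ _ h => funext fun n => congrFun (congrFun h n) 0

theorem finite_range_window (d : ℕ) {u : ℕ → α} (hu : (range u).Finite) :
    (range (window d u)).Finite :=
  (Finite.pi' fun _ => hu).subset (range_subset_iff.2 fun n i => mem_range_self (n + i))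

end Deterministic

/-! ### Polynomials in the shift operator -/

section SeqShift

/-- The shift operator `(a n) ↦ (a (n + 1))` on sequences, as a linear endomorphism, so that
`aeval (seqShift R) F` is the linear recurrence operator with characteristic polynomial `F`. -/
def seqShift (R : Type*) [CommSemiring R] : Module.End R (ℕ → R) :=
  LinearMap.funLeft R R Nat.succ

variable {R : Type*}

theorem seqShift_pow_apply [CommSemiring R] (i : ℕ) (a : ℕ → R) (n : ℕ) :
    (seqShift R ^ i) a n = a (n + i) := by
  induction i generalizing n with
  | zero => rfl
  | succ i ih =>
    rw [pow_succ', Module.End.mul_apply, ← Nat.succ_add_eq_add_succ]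
    exact ih (n + 1)

theorem aeval_seqShift_apply [CommSemiring R] (F : R[X]) (a : ℕ → R) (n : ℕ) :
    aeval (seqShift R) F a n = ∑ i ∈ F.support, F.coeff i * a (n + i) := by
  rw [aeval_def, eval₂_eq_sum, Polynomial.sum]
  simp [LinearMap.sum_apply, seqShift_pow_apply]

theorem aeval_seqShift_pow [CommSemiring R] (F : R[X]) (b : R) :
    aeval (seqShift R) F (fun n => b ^ n) = F.eval b • fun n => b ^ n := by
  funext n
  rw [aeval_seqShift_apply, Pi.smul_apply, smul_eq_mul, eval_eq_sum, Polynomial.sum, Finset.sum_mul]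
  exact Finset.sum_congr rfl fun i _ => by ring

theorem aeval_seqShift_map [CommSemiring R] {S : Type*} [CommSemiring S] (f : R →+* S) (F : R[X])
    (a : ℕ → R) :
    aeval (seqShift S) (F.map f) (fun n => f (a n)) = fun n => f (aeval (seqShift R) F a n) := by
  funext n
  induction F using Polynomial.induction_on' with
  | add p q hp hq => simp [hp, hq]
  | monomial i c => simp [aeval_monomial, seqShift_pow_apply]

theorem eq_zero_of_aeval_seqShift_eq_zero [CommRing R] [IsDomain R] {P : R[X]} (hP : P ≠ 0)
    {a : ℕ → R} (ha : aeval (seqShift R) P a = 0) (hinit : ∀ i < P.natDegree, a i = 0) :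
    a = 0 := by
  funext n
  induction n using Nat.strong_induction_on with
  | _ n ih =>
    rcases lt_or_ge n P.natDegree with hn | hn
    · exact hinit n hn
    obtain ⟨k, rfl⟩ := Nat.exists_eq_add_of_le' hn
    have hk := congrFun ha k
    rw [aeval_seqShift_apply, Finset.sum_eq_single_of_mem _ (natDegree_mem_support_of_nonzero hP)]
      at hk
    · exact (mul_eq_zero.1 hk).resolve_left (leadingCoeff_ne_zero.2 hP)
    · intro i hi hne
      have : i < P.natDegree := (le_natDegree_of_mem_supp i hi).lt_of_ne hne
      rw [ih (k + i) (by omega), Pi.zero_apply, mul_zero]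

theorem countable_preimage_aeval_seqShift [CommRing R] [IsDomain R] [Countable R] {P : R[X]}
    (hP : P ≠ 0) {U : Set (ℕ → R)} (hU : U.Countable) :
    (aeval (seqShift R) P ⁻¹' U).Countable := by
  have hinj : Function.Injective fun (a : ℕ → R) =>
      (aeval (seqShift R) P a, fun i : Fin P.natDegree => a i) := by
    intro a a' h
    obtain ⟨himage, hinit⟩ := Prod.mk.inj h
    refine sub_eq_zero.1 (eq_zero_of_aeval_seqShift_eq_zero hP ?_ fun i hi => ?_)
    · rw [map_sub, himage, sub_self]
    · exact sub_eq_zero.2 (congrFun hinit ⟨i, hi⟩)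
  exact ((hU.prod countable_univ).preimage hinj).mono fun a ha => mk_mem_prod ha (mem_univ _)

end SeqShift

theorem abs_coeff_le_polyLength (F : ℝ[X]) (i : ℕ) : |F.coeff i| ≤ polyLength F := by
  by_cases hi : i ∈ F.support
  · exact Finset.single_le_sum (f := fun i => |F.coeff i|) (fun _ _ => abs_nonneg _) hi
  · rw [notMem_support_iff.1 hi, abs_zero]
    exact Finset.sum_nonneg fun _ _ => abs_nonneg _

theorem abs_aeval_seqShift_sub_le (F : ℝ[X]) {s : ℕ → ℝ} {c : ℝ} (h : ∀ i j, |s i - s j| ≤ c)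
    (m n : ℕ) :
    |aeval (seqShift ℝ) F s m - aeval (seqShift ℝ) F s n| ≤ polyLength F * c := by
  rw [aeval_seqShift_apply, aeval_seqShift_apply, ← Finset.sum_sub_distrib, polyLength,
    Finset.sum_mul]
  refine (Finset.abs_sum_le_sum_abs _ _).trans (Finset.sum_le_sum fun i _ => ?_)
  rw [← mul_sub, abs_mul]
  exact mul_le_mul_of_nonneg_left (h _ _) (abs_nonneg _)

theorem one_le_polyLength_map_mul {P : ℤ[X]} (hP : P ≠ 0) {G : ℝ[X]} (hG : G ∈ GammaSet) :
    1 ≤ polyLength (P.map (Int.castRingHom ℝ) * G) := by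
  set Q := P.map (Int.castRingHom ℝ) with hQ
  have hQ0 : Q ≠ 0 := (Polynomial.map_ne_zero_iff (Int.castRingHom ℝ).injective_int).2 hP
  have hone : ∀ k, Q.coeff k ≠ 0 → 1 ≤ |Q.coeff k| := fun k => by
    rw [hQ, coeff_map, eq_intCast]
    exact_mod_cast Int.one_le_abs
  rcases hG with hconst | hlead
  · calc 1 ≤ |Q.trailingCoeff| := hone _ (trailingCoeff_nonzero_iff_nonzero.2 hQ0)
      _ = |(Q * G).trailingCoeff| := by
        rw [trailingCoeff_mul, trailingCoeff_eq_coeff_zero (p := G) (hconst ▸ one_ne_zero),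
          hconst, mul_one]
      _ ≤ polyLength (Q * G) := abs_coeff_le_polyLength _ _
  · calc 1 ≤ |Q.leadingCoeff| := hone _ (leadingCoeff_ne_zero.2 hQ0)
      _ = |(Q * G).leadingCoeff| := by rw [leadingCoeff_mul, hlead, mul_one]
      _ ≤ polyLength (Q * G) := abs_coeff_le_polyLength _ _

/-! ### Integer sequences of small oscillation -/

/-- The integer sequences `u` of finite range for which any two terms of `G(shift) u` differ by
less than `1`. For `G ∈ Γ` the integrality of `u` then makes `u` deterministic. -/
def smallOscillationSeqs (G : ℝ[X]) : Set (ℕ → ℤ) :=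
  {u | (range u).Finite ∧ ∀ m n, |aeval (seqShift ℝ) G (fun k => (u k : ℝ)) m -
    aeval (seqShift ℝ) G (fun k => (u k : ℝ)) n| < 1}

section SmallOscillation

variable {G : ℝ[X]} {u : ℕ → ℤ}

theorem eq_of_coeff_eq_one_of_mem_smallOscillationSeqs (hu : u ∈ smallOscillationSeqs G)
    {k m n : ℕ} (hk : G.coeff k = 1)
    (heq : ∀ i ≤ G.natDegree, i ≠ k → u (m + i) = u (n + i)) : u (m + k) = u (n + k) := by
  have hosc := hu.2 m n
  have hmem : k ∈ G.support := mem_support_iff.2 (hk ▸ one_ne_zero)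
  rw [aeval_seqShift_apply, aeval_seqShift_apply, ← Finset.sum_sub_distrib,
    Finset.sum_eq_single_of_mem k hmem, hk, one_mul, one_mul] at hosc
  · have : |u (m + k) - u (n + k)| < 1 := by exact_mod_cast hosc
    exact sub_eq_zero.1 (Int.abs_lt_one_iff.1 this)
  · intro i hi hne
    rw [heq i (le_natDegree_of_mem_supp i hi) hne, sub_self]

theorem window_succ_eq_of_leadingCoeff_eq_one (hu : u ∈ smallOscillationSeqs G)
    (hG : G.leadingCoeff = 1) {m n : ℕ}
    (h : window G.natDegree u m = window G.natDegree u n) :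
    window G.natDegree u (m + 1) = window G.natDegree u (n + 1) := by
  rw [window_eq_window_iff] at h ⊢
  have hinit : ∀ i < G.natDegree, u (m + 1 + i) = u (n + 1 + i) := fun i hi => by
    simpa only [Nat.succ_add_eq_add_succ] using h (i + 1) hi
  intro i hi
  rcases hi.lt_or_eq with hlt | rfl
  · exact hinit i hlt
  · exact eq_of_coeff_eq_one_of_mem_smallOscillationSeqs hu hG fun i hi hne =>
      hinit i (hi.lt_of_ne hne)

theorem window_eq_of_window_succ_eq_of_coeff_zero_eq_one (hu : u ∈ smallOscillationSeqs G)
    (hG : G.coeff 0 = 1) {m n : ℕ}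
    (h : window G.natDegree u (m + 1) = window G.natDegree u (n + 1)) :
    window G.natDegree u m = window G.natDegree u n := by
  rw [window_eq_window_iff] at h ⊢
  have htail : ∀ i ≤ G.natDegree, i ≠ 0 → u (m + i) = u (n + i) := by
    rintro (_ | i) hi hne
    · exact absurd rfl hne
    · simpa only [Nat.succ_add_eq_add_succ] using h i (by omega)
  intro i hi
  rcases eq_or_ne i 0 with rfl | hne
  · exact eq_of_coeff_eq_one_of_mem_smallOscillationSeqs hu hG htail
  · exact htail i hi hne

theorem countable_smallOscillationSeqs (hG : G ∈ GammaSet) :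
    (smallOscillationSeqs G).Countable := by
  refine (countable_setOf_finite_range_deterministic.preimage
    (window_injective G.natDegree)).mono fun u hu => ?_
  have hfin := finite_range_window G.natDegree hu.1
  refine ⟨hfin, fun m n h => ?_⟩
  rcases hG with hconst | hlead
  · exact succ_eq_succ_of_finite_range hfin
      (fun _ _ => window_eq_of_window_succ_eq_of_coeff_zero_eq_one hu hconst) h
  · exact window_succ_eq_of_leadingCoeff_eq_one hu hlead h

end SmallOscillation

/-! ### Dilates of a recurrent sequence with small fractional parts -/

section FractLt

variable {a : ℕ → ℝ} {x t δ : ℝ}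

-- `F(shift)` kills `x a` and maps the constant `t` to a constant, so only the fractional parts
-- contribute to the oscillation.
theorem abs_aeval_seqShift_floor_sub_le {F : ℝ[X]} (hF : aeval (seqShift ℝ) F a = 0)
    (hδ : ∀ n, Int.fract (x * a n + t) < δ) (m n : ℕ) :
    |aeval (seqShift ℝ) F (fun k => (⌊x * a k + t⌋ : ℝ)) m -
      aeval (seqShift ℝ) F (fun k => (⌊x * a k + t⌋ : ℝ)) n| ≤ polyLength F * δ := by
  set s : ℕ → ℝ := fun k => Int.fract (x * a k + t)
  have hfloor : (fun k => (⌊x * a k + t⌋ : ℝ)) = x • a + t • (fun k => (1 : ℝ) ^ k) - s := by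
    funext k
    simp [s, ← Int.self_sub_floor]
  have hact : ∀ k, aeval (seqShift ℝ) F (fun k => (⌊x * a k + t⌋ : ℝ)) k =
      t * F.eval 1 - aeval (seqShift ℝ) F s k := by
    intro k
    rw [hfloor, map_sub, map_add, map_smul, map_smul, hF, aeval_seqShift_pow]
    simp
  rw [hact, hact, sub_sub_sub_cancel_left]
  refine abs_aeval_seqShift_sub_le F (fun i j => abs_le.2 ?_) n m
  have hnonneg : ∀ k, 0 ≤ s k := fun k => Int.fract_nonneg _
  constructor <;> linarith [hnonneg i, hnonneg j, hδ i, hδ j]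

theorem finite_range_of_abs_sub_le {ι : Type*} {u : ι → ℤ} {z : ℤ} {C : ℝ}
    (h : ∀ i, |(u i : ℝ) - z| ≤ C) : (range u).Finite := by
  refine (isCompact_closedBall z C).finite_of_discrete.subset (range_subset_iff.2 fun i => ?_)
  rw [Metric.mem_closedBall, Int.dist_eq]
  exact h i

theorem aeval_seqShift_floor_mem_smallOscillationSeqs {P : ℤ[X]}
    (ha : aeval (seqShift ℝ) (P.map (Int.castRingHom ℝ)) a = 0) {G : ℝ[X]}
    (hδG : polyLength (P.map (Int.castRingHom ℝ) * G) * δ < 1)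
    (hδ : ∀ n, Int.fract (x * a n + t) < δ) :
    aeval (seqShift ℤ) P (fun n => ⌊x * a n + t⌋) ∈ smallOscillationSeqs G := by
  set Q := P.map (Int.castRingHom ℝ)
  set u := aeval (seqShift ℤ) P (fun n => ⌊x * a n + t⌋)
  have hcast : (fun n => (u n : ℝ)) = aeval (seqShift ℝ) Q fun n => (⌊x * a n + t⌋ : ℝ) :=
    (aeval_seqShift_map (Int.castRingHom ℝ) P _).symm
  have hmul : ∀ s : ℕ → ℝ, aeval (seqShift ℝ) G (aeval (seqShift ℝ) Q s) =
      aeval (seqShift ℝ) (Q * G) s := fun s => by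
    rw [mul_comm, map_mul, Module.End.mul_apply]
  have hbound : ∀ n, |(u n : ℝ) - u 0| ≤ polyLength Q * δ := fun n => by
    simpa only [← hcast] using abs_aeval_seqShift_floor_sub_le ha hδ n 0
  refine ⟨finite_range_of_abs_sub_le hbound, fun m n => ?_⟩
  rw [hcast, hmul]
  refine (abs_aeval_seqShift_floor_sub_le ?_ hδ m n).trans_lt hδG
  rw [← hmul, ha, map_zero]

end FractLt

theorem not_isBounded_image_affine {K : Type*} [NormedField K] {A : Set K} (hA : ¬ IsBounded A)
    {x : K} (hx : x ≠ 0) (t : K) : ¬ IsBounded ((fun a => x * a + t) '' A) := by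
  simp only [isBounded_iff_forall_norm_le, forall_mem_image] at hA ⊢
  rintro ⟨C, hC⟩
  refine hA ⟨(C + ‖t‖) / ‖x‖, fun a ha => (le_div_iff₀' (norm_pos_iff.2 hx)).2 ?_⟩
  calc ‖x‖ * ‖a‖ = ‖x * a + t - t‖ := by rw [add_sub_cancel_right, norm_mul]
    _ ≤ ‖x * a + t‖ + ‖t‖ := norm_sub_le _ _
    _ ≤ C + ‖t‖ := by gcongr; exact hC ha

theorem eq_of_forall_floor_eq {ι : Type*} {a : ι → ℝ} (hunb : ¬ IsBounded (range a))
    {x x' t t' : ℝ} (h : ∀ i, ⌊x * a i + t⌋ = ⌊x' * a i + t'⌋) : x = x' := by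
  by_contra hne
  refine not_isBounded_image_affine hunb (sub_ne_zero.2 hne) (t - t')
    (isBounded_iff_forall_norm_le.2 ⟨1, ?_⟩)
  rintro _ ⟨_, ⟨i, rfl⟩, rfl⟩
  have hclose := Int.abs_sub_lt_one_of_floor_eq_floor (h i)
  rw [Real.norm_eq_abs]
  exact (congrArg abs (by ring)).trans_le hclose.le

theorem countable_setOf_fract_lt {a : ℕ → ℝ} (hunb : ¬ IsBounded (range a)) {P : ℤ[X]}
    (hP : P ≠ 0) (ha : aeval (seqShift ℝ) (P.map (Int.castRingHom ℝ)) a = 0) {G : ℝ[X]}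
    (hG : G ∈ GammaSet) {δ : ℝ} (hδ : polyLength (P.map (Int.castRingHom ℝ) * G) * δ < 1) :
    {x : ℝ | ∃ t : ℝ, ∀ n, Int.fract (x * a n + t) < δ}.Countable := by
  choose! t ht using fun (x : ℝ) (hx : ∃ t : ℝ, ∀ n, Int.fract (x * a n + t) < δ) => hx
  have hmaps : MapsTo (fun x n => ⌊x * a n + t x⌋)
      {x : ℝ | ∃ t : ℝ, ∀ n, Int.fract (x * a n + t) < δ}
      (aeval (seqShift ℤ) P ⁻¹' smallOscillationSeqs G) := fun x hx =>
    aeval_seqShift_floor_mem_smallOscillationSeqs ha hδ (ht x hx)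
  have hinj : Function.Injective fun x n => ⌊x * a n + t x⌋ := fun x x' h =>
    eq_of_forall_floor_eq hunb (congrFun h)
  exact hmaps.countable_of_injOn hinj.injOn
    (countable_preimage_aeval_seqShift hP (countable_smallOscillationSeqs hG))

/-! ### Sparse sets meeting all translates of countably many dilates -/

section Separated

variable {E : Type*} [SeminormedAddCommGroup E]

theorem exists_seq_pairwise_le_norm_sub {A : ℕ → Set E} (hA : ∀ k, ¬ IsBounded (A k)) (d : ℝ) :
    ∃ c : ℕ → E, (∀ k, c k ∈ A k) ∧ Pairwise fun k l => d ≤ ‖c k - c l‖ := by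
  have hfar : ∀ k (r : ℝ), ∃ y ∈ A k, r < ‖y‖ := fun k r => by
    by_contra! h
    exact hA k (isBounded_iff_forall_norm_le.2 ⟨r, h⟩)
  choose far hfar_mem hfar_lt using hfar
  let c : ℕ → E := Nat.rec (far 0 0) fun k y => far (k + 1) (‖y‖ + |d|)
  have hmem : ∀ k, c k ∈ A k := by rintro (_ | k) <;> exact hfar_mem _ _
  have hstep : ∀ k, ‖c k‖ + |d| ≤ ‖c (k + 1)‖ := fun k => (hfar_lt _ _).le
  have hmono : Monotone fun k => ‖c k‖ := monotone_nat_of_le_succ fun k =>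
    (le_add_of_nonneg_right (abs_nonneg d)).trans (hstep k)
  have hsep : ∀ k l, k < l → d ≤ ‖c l - c k‖ := fun k l hkl => by
    linarith [hstep k, hmono (Nat.succ_le_of_lt hkl), norm_sub_norm_le (c l) (c k), le_abs_self d]
  refine ⟨c, hmem, fun k l hne => ?_⟩
  rcases hne.lt_or_gt with hlt | hgt
  · exact norm_sub_rev (c k) (c l) ▸ hsep k l hlt
  · exact hsep l k hgt

theorem exists_pairwise_le_norm_sub {ι : Type*} [Countable ι] {A : ι → Set E}
    (hA : ∀ i, ¬ IsBounded (A i)) (d : ℝ) :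
    ∃ c : ι → E, (∀ i, c i ∈ A i) ∧ Pairwise fun i j => d ≤ ‖c i - c j‖ := by
  rcases isEmpty_or_nonempty ι with hι | hι
  · exact ⟨isEmptyElim, isEmptyElim, fun i => isEmptyElim i⟩
  obtain ⟨e, he⟩ := exists_surjective_nat ι
  obtain ⟨c, hmem, hsep⟩ := exists_seq_pairwise_le_norm_sub (fun k => hA (e k)) d
  refine ⟨fun i => c (Function.surjInv he i), fun i => ?_,
    hsep.comp_of_injective (Function.injective_surjInv he)⟩
  simpa only [Function.surjInv_eq] using hmem (Function.surjInv he i)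

end Separated

theorem volume_iUnion_Ico_inter_Icc_le {ι : Type*} {c : ι → ℝ} {κ : ℝ}
    (hc : Pairwise fun i j => κ + 1 ≤ |c i - c j|) (a : ℝ) :
    volume ((⋃ i, Ico (c i) (c i + κ)) ∩ Icc a (a + 1)) ≤ ENNReal.ofReal κ := by
  rcases ((⋃ i, Ico (c i) (c i + κ)) ∩ Icc a (a + 1)).eq_empty_or_nonempty with hempty | hne
  · rw [hempty, measure_empty]
    exact zero_le
  obtain ⟨y, hy, hya⟩ := hne
  obtain ⟨i, hyi⟩ := mem_iUnion.1 hy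
  calc volume ((⋃ i, Ico (c i) (c i + κ)) ∩ Icc a (a + 1))
      ≤ volume (Ico (c i) (c i + κ)) := measure_mono ?_
    _ = ENNReal.ofReal κ := by rw [Real.volume_Ico, add_sub_cancel_left]
  rintro z ⟨hz, hza⟩
  obtain ⟨j, hzj⟩ := mem_iUnion.1 hz
  have hclose : |c i - c j| < κ + 1 :=
    abs_lt.2 ⟨by linarith [hyi.2, hzj.1, hya.1, hza.2], by linarith [hyi.1, hzj.2, hya.2, hza.1]⟩
  rwa [hc.eq fun h => h.not_gt hclose]

theorem exists_sparse_set_meeting_affine_images {A : Set ℝ} (hA : ¬ IsBounded A) {X : Set ℝ}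
    (hX : X.Countable) (hX0 : 0 ∉ X) {κ : ℝ} (hκ : 0 < κ) :
    ∃ E : Set ℝ, MeasurableSet E ∧
      (∀ a, volume (E ∩ Icc a (a + 1)) ≤ ENNReal.ofReal κ) ∧
      ∀ x ∈ X, ∀ t : ℝ, ∃ a ∈ A, x * a + t ∈ E := by
  have : Countable X := hX.to_subtype
  obtain ⟨c, hc, hsep⟩ := exists_pairwise_le_norm_sub (ι := X × ℤ)
    (fun i => not_isBounded_image_affine hA (ne_of_mem_of_not_mem i.1.2 hX0) (i.2 * κ)) (κ + 1)
  refine ⟨⋃ i, Ico (c i) (c i + κ), .iUnion fun _ => measurableSet_Ico,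
    volume_iUnion_Ico_inter_Icc_le hsep, fun x hx t => ?_⟩
  obtain ⟨a, haA, hca⟩ := hc (⟨x, hx⟩, ⌊t / κ⌋)
  have hle : (⌊t / κ⌋ : ℝ) * κ ≤ t := (le_div_iff₀ hκ).1 (Int.floor_le _)
  have hlt : t < (⌊t / κ⌋ + 1 : ℝ) * κ := (div_lt_iff₀ hκ).1 (Int.lt_floor_add_one _)
  refine ⟨a, haA, mem_iUnion.2 ⟨(⟨x, hx⟩, ⌊t / κ⌋), ?_⟩⟩
  rw [← hca]
  constructor <;> linarith

/-! ### Large sets -/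

theorem IsLargeSet.sdiff {c κ : ℝ} {S E : Set ℝ} (hS : IsLargeSet c S) (hE : MeasurableSet E)
    (hκ : 0 ≤ κ) (hEκ : ∀ a, volume (E ∩ Icc a (a + 1)) ≤ ENNReal.ofReal κ) :
    IsLargeSet (c - κ) (S \ E) := by
  refine ⟨hS.1.diff hE.nullMeasurableSet, fun a => ?_⟩
  calc ENNReal.ofReal (c - κ) = ENNReal.ofReal c - ENNReal.ofReal κ := ENNReal.ofReal_sub _ hκ
    _ ≤ volume (S ∩ Icc a (a + 1)) - volume (E ∩ Icc a (a + 1)) :=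
      tsub_le_tsub (hS.2 a) (hEκ a)
    _ ≤ volume ((S ∩ Icc a (a + 1)) \ (E ∩ Icc a (a + 1))) := le_measure_sdiff
    _ = volume ((S \ E) ∩ Icc a (a + 1)) := by rw [← inter_sdiff_distrib_right]

theorem isLargeSet_setOf_fract_lt {δ : ℝ} (hδ : δ ≤ 1) :
    IsLargeSet δ {y : ℝ | Int.fract y < δ} := by
  have hmeas : MeasurableSet {y : ℝ | Int.fract y < δ} :=
    measurableSet_lt measurable_fract measurable_const
  have hperiodic : ∀ z : AddSubgroup.zmultiples (1 : ℝ),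
      (fun y => z +ᵥ y) ⁻¹' {y : ℝ | Int.fract y < δ} = {y : ℝ | Int.fract y < δ} := by
    rintro ⟨_, k, rfl⟩
    ext y
    simp [AddSubgroup.vadd_def]
  refine ⟨hmeas.nullMeasurableSet, fun a => ?_⟩
  calc ENNReal.ofReal δ = volume (Ioo 0 δ) := by rw [Real.volume_Ioo, sub_zero]
    _ ≤ volume ({y : ℝ | Int.fract y < δ} ∩ Ioc 0 (0 + 1)) := measure_mono fun y hy => by
      have hy1 : y < 1 := hy.2.trans_le hδ
      refine ⟨?_, hy.1, by linarith⟩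
      rw [mem_ofPred_eq, Int.fract_eq_self.2 ⟨hy.1.le, hy1⟩]
      exact hy.2
    _ = volume ({y : ℝ | Int.fract y < δ} ∩ Ioc a (a + 1)) :=
      (isAddFundamentalDomain_Ioc one_pos 0).measure_set_eq
        (isAddFundamentalDomain_Ioc one_pos a) hmeas hperiodic
    _ ≤ volume ({y : ℝ | Int.fract y < δ} ∩ Icc a (a + 1)) := by gcongr; exact Ioc_subset_Icc_self

theorem exists_isLargeSet_not_containsAffineCopy_range {a : ℕ → ℝ} (hunb : ¬ IsBounded (range a))
    {P : ℤ[X]} (hP : P ≠ 0) (ha : aeval (seqShift ℝ) (P.map (Int.castRingHom ℝ)) a = 0)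
    {G : ℝ[X]} (hG : G ∈ GammaSet) {c : ℝ}
    (hc : c * polyLength (P.map (Int.castRingHom ℝ) * G) < 1) :
    ∃ S : Set ℝ, IsLargeSet c S ∧ ¬ ContainsAffineCopy S (range a) := by
  have hlength := one_le_polyLength_map_mul hP hG
  set L := polyLength (P.map (Int.castRingHom ℝ) * G)
  have hL : 0 < L := one_pos.trans_le hlength
  obtain ⟨δ, hcδ, hδL⟩ : ∃ δ, c < δ ∧ δ < 1 / L := exists_between ((lt_div_iff₀ hL).2 hc)
  have hδ1 : δ ≤ 1 := hδL.le.trans ((div_le_one hL).2 hlength)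
  have hX := countable_setOf_fract_lt hunb hP ha hG ((lt_div_iff₀' hL).1 hδL)
  obtain ⟨E, hE, hEvol, hEmeets⟩ := exists_sparse_set_meeting_affine_images hunb
    (hX.mono sdiff_subset) (notMem_sdiff_of_mem (mem_singleton 0)) (sub_pos.2 hcδ)
  refine ⟨{y | Int.fract y < δ} \ E, ?_, ?_⟩
  · simpa only [sub_sub_cancel] using
      (isLargeSet_setOf_fract_lt hδ1).sdiff hE (sub_pos.2 hcδ).le hEvol
  · rintro ⟨x, t, hx, hsub⟩
    have hmem : ∀ y ∈ range a, x * y + t ∈ {y : ℝ | Int.fract y < δ} \ E := fun y hy =>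
      hsub (mem_image_of_mem _ hy)
    obtain ⟨y, hya, hyE⟩ := hEmeets x ⟨⟨t, fun n => (hmem _ (mem_range_self n)).1⟩, hx⟩ t
    exact (hmem y hya).2 hyE

/-! ### The reduced length -/

theorem gammaSet_nonempty : GammaSet.Nonempty := ⟨1, Or.inr leadingCoeff_one⟩

theorem one_le_reducedLength {b : ℝ} (hb : IsAlgebraic ℚ b) : 1 ≤ reducedLength b := by
  refine le_csInf (gammaSet_nonempty.image _) (forall_mem_image.2 fun G hG => ?_)
  exact one_le_polyLength_map_mul (intMinpoly_spec hb).1.ne_zero hG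

theorem exists_mem_gammaSet_mul_polyLength_lt {b c r : ℝ} (hc : 0 ≤ c)
    (h : c * reducedLength b < r) :
    ∃ G ∈ GammaSet, c * polyLength ((intMinpoly b).map (Int.castRingHom ℝ) * G) < r := by
  rw [reducedLength, ← smul_eq_mul, ← Real.sInf_smul_of_nonneg hc] at h
  obtain ⟨_, ⟨_, ⟨G, hG, rfl⟩, rfl⟩, hlt⟩ :=
    exists_lt_of_csInf_lt (gammaSet_nonempty.image _).smul_set h
  exact ⟨G, hG, hlt⟩

theorem not_isBounded_range_pow {K : Type*} [NormedDivisionRing K] {b : K} (hb : 1 < ‖b‖) :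
    ¬ IsBounded (range fun n : ℕ => b ^ n) := by
  rw [isBounded_iff_forall_norm_le]
  rintro ⟨C, hC⟩
  obtain ⟨n, hn⟩ := pow_unbounded_of_one_lt C hb
  exact (hC _ (mem_range_self n)).not_gt (by rwa [norm_pow])

theorem theorem1p5_general (b : ℝ) (hb : 1 < |b|) (hb_alg : IsAlgebraic ℚ b)
    (ε : ℝ) (hε : ε ∈ Ioc (1 - 1 / reducedLength b) 1) :
    ∃ S : Set ℝ, IsLargeSet (1 - ε) S ∧
      ¬ ContainsAffineCopy S (range fun n : ℕ => b ^ n) := by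
  obtain ⟨hirr, -, hroot⟩ := intMinpoly_spec hb_alg
  have hannihilated : aeval (seqShift ℝ) ((intMinpoly b).map (Int.castRingHom ℝ))
      (fun n => b ^ n) = 0 := by
    rw [aeval_seqShift_pow, eval_map, ← algebraMap_int_eq, ← aeval_def, hroot, zero_smul]
  have hlt : (1 - ε) * reducedLength b < 1 :=
    (lt_div_iff₀ (one_pos.trans_le (one_le_reducedLength hb_alg))).1 (sub_lt_comm.1 hε.1)
  obtain ⟨G, hG, hGlt⟩ := exists_mem_gammaSet_mul_polyLength_lt (sub_nonneg.2 hε.2) hlt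
  exact exists_isLargeSet_not_containsAffineCopy_range (not_isBounded_range_pow hb)
    hirr.ne_zero hannihilated hG hGlt

theorem theorem1p5 (b : ℝ) (hb : 1 < b) (hb_alg : IsAlgebraic ℚ b)
    (ε : ℝ) (hε : ε ∈ Set.Ioc (1 - 1 / reducedLength b) 1) :
    ∃ S : Set ℝ, IsLargeSet (1 - ε) S ∧
      ¬ ContainsAffineCopy S (Set.range fun n : ℕ => b ^ n) :=
  theorem1p5_general b (hb.trans_le (le_abs_self b)) hb_alg ε hε
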